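/- Let $w_0,\dots,w_{\beta-1}$ be any finite collection of strings (documents), of total length $n$, and let $T$ be their generalised suffix tree, i.e. the compacted trie of all suffixes of $w_0\$_0,\dots,w_{\beta-1}\$_{\beta-1}$, where the $\$_k$ are distinct characters that occur in no document. A (possibly implicit) node of $T$ is identified with the string that it represents; it is explicit if it is the root, a leaf, or has at least two children in the uncompacted trie. Every explicit node has a pointer, and the pointers are arbitrary distinct machine words. Let $\ell$ be a natural number, let $r$ be a primitive string (not of the form $v^i$ with $i>1$) with $|r|\le \ell/4$, let $T_r$ be the part of $T$ that consists of all nodes representing substrings of $r^\infty$ of length at least $\ell/2$, and let $s$ be the number of explicit nodes in $T_r$. Work in the word-RAM model with logarithmic word size: words have $W\ge\kappa\log_2 n$ bits, where $\kappa$ is an absolute constant. Then $T_r$ has a static data structure of $O(|r|\log|r|+s+1)$ words such that, in $O(1)$ worst-case time, the node corresponding to any substring $x$ of $r^\infty$ of length at least $\frac34\ell$ that is represented in $T$ can be retrieved. In detail: there are a single word-RAM program and absolute constants $C,\kappa$ such that for all data as above there is an array $D$ of at most $C(|r|\log_2|r|+s+1)$ words with the following property. For each such $x$, given by a starting position $0\le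 i<|r|$ in $r^\infty$ and its length $|x|$, the program, run on the memory image $D$ with arguments $i$ and $|x|$, stops after at most $C$ steps, leaves the memory as it was, and reports whether the node of $x$ is explicit, together with the pointer to this node if it is explicit, and otherwise with the pointer to the lower endpoint of the edge of $T$ on which it lies (which identifies that edge). -/

import Mathlib

/-! ## Strings -/

/-- The `i`-th power `v v ... v` of a string. -/
def strPow {α : Type*} (v : List α) (i : ℕ) : List α := (List.replicate i v).flatten

/-- A string is primitive if it is not `v ^ i` with `i > 1` (so the empty string is not primitive). -/
def IsPrimitive {α : Type*} (u : List α) : Prop :=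
  ∀ (v : List α) (i : ℕ), 1 < i → u ≠ strPow v i

/-- `x` is the substring of `r r r ...` (infinitely often) that starts at (0-based) position `i`
and has length `x.length`. -/
def OccursInPowAt {α : Type*} (r : List α) (i : ℕ) (x : List α) : Prop :=
  ∀ j < x.length, x[j]? = r[(i + j) % r.length]?

/-! ## Compacted tries and generalised suffix trees

A node of a trie, implicit or explicit, is identified with the string it represents. -/

/-- The nodes, implicit and explicit, of the (compacted) trie of a set of strings. -/
def trieNodes {β : Type*} (S : Set (List β)) : Set (List β) := {u | ∃ x ∈ S, u <+: x}

/-- A node of the compacted trie is explicit if it is the root, or a leaf (no child), or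
branching (at least two children). -/
def IsExplicitNode {β : Type*} (S : Set (List β)) (u : List β) : Prop :=
  u ∈ trieNodes S ∧ (u = [] ∨ ¬ ∃! c : β, u ++ [c] ∈ trieNodes S)

/-- `v` is the topmost explicit node in the subtree of `u` (including `u` itself): it is `u` if `u`
is explicit, and otherwise the lower endpoint of the edge on which the implicit node `u` lies. -/
def IsLocus {β : Type*} (S : Set (List β)) (u v : List β) : Prop :=
  IsExplicitNode S v ∧ u <+: v ∧ ∀ v', IsExplicitNode S v' → u <+: v' → v <+: v'

/-- A string over the alphabet `α`, as a string over `α` extended by separators. -/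
def plain {α : Type*} (x : List α) : List (α ⊕ ℕ) := x.map Sum.inl

/-- All suffixes of `w₀ $₀, w₁ $₁, ...`, where `docs = [w₀, w₁, ...]` and `$ₖ = Sum.inr k`. The
generalised suffix tree of `docs` is the compacted trie of this set. -/
def gstSuffixes {α : Type*} (docs : List (List α)) : Set (List (α ⊕ ℕ)) :=
  {x | ∃ (k : ℕ) (w : List α), docs[k]? = some w ∧ x <:+ plain w ++ [Sum.inr k]}

/-- The nodes of `T_r`: the nodes of the generalised suffix tree of `docs` that represent
substrings of `r r r ...` of length at least `ℓ / 2`. -/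
def periodicPart {α : Type*} (docs : List (List α)) (r : List α) (ℓ : ℕ) : Set (List (α ⊕ ℕ)) :=
  {u | u ∈ trieNodes (gstSuffixes docs) ∧
    ∃ (x : List α) (i : ℕ), u = plain x ∧ OccursInPowAt r i x ∧ ℓ ≤ 2 * x.length}

/-- The number of explicit nodes in `T_r`. -/
noncomputable def numExplicitPeriodic {α : Type*} (docs : List (List α)) (r : List α) (ℓ : ℕ) : ℕ :=
  {u | u ∈ periodicPart docs r ℓ ∧ IsExplicitNode (gstSuffixes docs) u}.ncard

/-! ## The word RAM -/

namespace WordRAM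

/-- The binary operations of the word RAM. -/
inductive BinOp where
  | add | sub | mul | div | mod | and | or | xor | shl | shr | eq | lt

/-- Operations on words of `W` bits, represented by natural numbers below `2 ^ W`; arithmetic is
modulo `2 ^ W`, and comparisons return 0 or 1. -/
def BinOp.eval (W : ℕ) (o : BinOp) (x y : ℕ) : ℕ :=
  match o with
  | .add => (x + y) % 2 ^ W
  | .sub => (x + (2 ^ W - y % 2 ^ W)) % 2 ^ W
  | .mul => (x * y) % 2 ^ W
  | .div => (x / y) % 2 ^ W
  | .mod => (x % y) % 2 ^ W
  | .and => (Nat.land x y) % 2 ^ W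
  | .or => (Nat.lor x y) % 2 ^ W
  | .xor => (Nat.xor x y) % 2 ^ W
  | .shl => (Nat.shiftLeft x y) % 2 ^ W
  | .shr => (Nat.shiftRight x y) % 2 ^ W
  | .eq => (if x = y then 1 else 0) % 2 ^ W
  | .lt => (if x < y then 1 else 0) % 2 ^ W

/-- The instructions; `d`, `a`, `b` are numbers of registers and `t` is a position in the program.
`const d c`: put `c` into `d`. `op o d a b`: put the result of `o` on `a` and `b` into `d`.
`load d a`: put the memory word whose address is in `a` into `d`. `store a b`: put the content of
`b` into the memory word whose address is in `a`. `jump t`: go to `t`. `jumpZero a t`: go to `t` if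
`a` contains 0. -/
inductive Instr where
  | const (d c : ℕ)
  | op (o : BinOp) (d a b : ℕ)
  | load (d a : ℕ)
  | store (a b : ℕ)
  | jump (t : ℕ)
  | jumpZero (a t : ℕ)
  | halt

/-- A program is a finite list of instructions; it mentions finitely many registers. -/
abbrev Program := List Instr

/-- A configuration: program counter, registers, memory. -/
structure Config where
  pc : ℕ
  reg : ℕ → ℕ
  mem : ℕ → ℕ

/-- The machine has stopped: it is at a `halt` or outside the program. -/
def Halted (P : Program) (s : Config) : Prop := P[s.pc]? = none ∨ P[s.pc]? = some Instr.halt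

/-- One step of computation (unit cost), with words of `W` bits. -/
def step (W : ℕ) (P : Program) (s : Config) : Config :=
  match P[s.pc]? with
  | none => s
  | some .halt => s
  | some (.const d c) => ⟨s.pc + 1, Function.update s.reg d (c % 2 ^ W), s.mem⟩
  | some (.op o d a b) =>
      ⟨s.pc + 1, Function.update s.reg d (o.eval W (s.reg a) (s.reg b)), s.mem⟩
  | some (.load d a) => ⟨s.pc + 1, Function.update s.reg d (s.mem (s.reg a)), s.mem⟩
  | some (.store a b) => ⟨s.pc + 1, s.reg, Function.update s.mem (s.reg a) (s.reg b)⟩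
  | some (.jump t) => ⟨t, s.reg, s.mem⟩
  | some (.jumpZero a t) => ⟨if s.reg a = 0 then t else s.pc + 1, s.reg, s.mem⟩

/-- The configuration after `t` steps. -/
def run (W : ℕ) (P : Program) (t : ℕ) (s : Config) : Config := (step W P)^[t] s

/-- The memory that contains the words of `D` at the addresses `0, 1, ...` and 0 elsewhere. -/
def memOf (D : List ℕ) : ℕ → ℕ := fun a => D.getD a 0

/-- The start of a computation on the memory image `D` with arguments `x` and `y` in
registers 0 and 1; all other registers contain 0. -/
def start (D : List ℕ) (x y : ℕ) : Config :=
  ⟨0, fun k => if k = 0 then x else if k = 1 then y else 0, memOf D⟩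

/-- On memory image `D` and arguments `x`, `y`, the program stops after at most `c` steps with
`out₀` in register 0 and `out₁` in register 1, and with the memory as it was at the start. -/
def AnswersWithin (W : ℕ) (P : Program) (c : ℕ) (D : List ℕ) (x y out₀ out₁ : ℕ) : Prop :=
  ∃ t ≤ c, Halted P (run W P t (start D x y)) ∧
    (run W P t (start D x y)).reg 0 = out₀ ∧
    (run W P t (start D x y)).reg 1 = out₁ ∧
    (run W P t (start D x y)).mem = memOf D

end WordRAM

/-!
The substrings of `r^∞` of length at least `B = ⌈ℓ / 2⌉` are indexed by pairs `(c, y)`: the residue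
`c` modulo `|r|` of the end position and the excess `y` of the length over `B`. Suffixes of explicit
nodes are explicit, so in column `c` the explicit nodes are those with `y < h c` for some height
`h c`, and since `r` is primitive, distinct pairs are distinct strings, so `∑ c, h c ≤ s`. A string
that is not explicit has the same locus as its one-letter extension in `T_r`, so the locus is
constant along the diagonal `(c, y)`, `(c + 1, y + 1)`, ... until the latter enters a column below
its height. Queries have `y ≥ |r|`, since `3 ℓ / 4 ≥ ℓ / 2 + |r|`. If `b |r| ≤ y < (b + 1) |r|`, one
can follow the diagonal to the first column with `h > b |r|`, which does not depend on `y` and is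
less than `|r|` steps away; as `b > 0`, the diagonal is below `3 h` there. It therefore suffices to
store the loci for `y < 3 h c`, and one pointer for each column `c` and each block `b`. Above all
columns, the locus depends only on the starting position.
-/

/-! ## Searching in a trie -/

section Trie

variable {β : Type*} {S : Set (List β)} {u v v' : List β} {c : β}

theorem mem_trieNodes_of_prefix (h : u <+: v) (hv : v ∈ trieNodes S) : u ∈ trieNodes S := by
  obtain ⟨x, hx, hvx⟩ := hv
  exact ⟨x, hx, h.trans hvx⟩

theorem existsUnique_child_of_not_isExplicitNode (hu : u ∈ trieNodes S)
    (hne : ¬ IsExplicitNode S u) : ∃! c, u ++ [c] ∈ trieNodes S :=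
  by_contra fun h => hne ⟨hu, Or.inr h⟩

theorem IsExplicitNode.isLocus_self (h : IsExplicitNode S u) : IsLocus S u u :=
  ⟨h, List.prefix_rfl, fun _ _ h => h⟩

theorem IsLocus.unique (h : IsLocus S u v) (h' : IsLocus S u v') : v = v' := by
  have hvv' : v <+: v' := h.2.2 v' h'.1 h'.2.1
  have hv'v : v' <+: v := h'.2.2 v h.1 h.2.1
  exact hvv'.eq_of_length (le_antisymm hvv'.length_le hv'v.length_le)

theorem IsLocus.of_child (hne : ¬ IsExplicitNode S u) (hc : u ++ [c] ∈ trieNodes S)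
    (h : IsLocus S (u ++ [c]) v) : IsLocus S u v := by
  refine ⟨h.1, (List.prefix_append _ _).trans h.2.1, fun v' hv' huv' => h.2.2 v' hv' ?_⟩
  have huniq := existsUnique_child_of_not_isExplicitNode
    (mem_trieNodes_of_prefix (List.prefix_append _ _) hc) hne
  obtain ⟨_ | ⟨d, t⟩, rfl⟩ := huv'
  · exact absurd (by simpa using hv') hne
  · have hd : u ++ [d] ∈ trieNodes S := mem_trieNodes_of_prefix ⟨t, by simp⟩ hv'.1
    rw [huniq.unique hc hd]
    exact ⟨t, by simp⟩

theorem exists_isLocus_of_length_le {N : ℕ} (hN : ∀ u ∈ trieNodes S, u.length ≤ N)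
    (hu : u ∈ trieNodes S) : ∃ v, IsLocus S u v := by
  induction hk : N + 1 - u.length generalizing u with
  | zero => have := hN u hu; omega
  | succ k ih =>
    by_cases he : IsExplicitNode S u
    · exact ⟨u, he.isLocus_self⟩
    · obtain ⟨c, hc, -⟩ := existsUnique_child_of_not_isExplicitNode hu he
      obtain ⟨v, hv⟩ := ih hc (by simp only [List.length_append, List.length_singleton]; omega)
      exact ⟨v, hv.of_child he hc⟩

theorem IsExplicitNode.of_cons {a : β} (hS : ∀ a u, a :: u ∈ trieNodes S → u ∈ trieNodes S)
    (h : IsExplicitNode S (a :: u)) (hc : a :: u ++ [c] ∈ trieNodes S) : IsExplicitNode S u := by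
  refine ⟨hS _ _ h.1, Or.inr fun huniq => ?_⟩
  refine h.2.resolve_left (List.cons_ne_nil _ _) ⟨c, hc, fun c' hc' => ?_⟩
  exact huniq.unique (hS _ _ hc') (hS _ _ hc)

open Classical in
/-- The longest prefix of `u` that is a node of the trie of `S`, i.e. the node at which the search
for `u` from the root ends. It is meaningful only if the trie is nonempty. -/
noncomputable def longestMatch (S : Set (List β)) (u : List β) : List β :=
  u.take (Nat.findGreatest (fun m => u.take m ∈ trieNodes S) u.length)

theorem longestMatch_mem (hroot : [] ∈ trieNodes S) (u : List β) :
    longestMatch S u ∈ trieNodes S := by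
  classical
  exact Nat.findGreatest_spec (P := fun m => u.take m ∈ trieNodes S) (Nat.zero_le _)
    (by simpa using hroot)

theorem longestMatch_of_mem (hu : u ∈ trieNodes S) : longestMatch S u = u := by
  classical
  exact List.take_of_length_le (Nat.le_findGreatest le_rfl (by simpa using hu))

theorem longestMatch_concat_of_notMem (h : u ++ [c] ∉ trieNodes S) :
    longestMatch S (u ++ [c]) = longestMatch S u := by
  classical
  have htake : ∀ m ≤ u.length, (u ++ [c]).take m = u.take m := fun m hm =>
    List.take_append_of_le_length hm
  have hfind : Nat.findGreatest (fun m => (u ++ [c]).take m ∈ trieNodes S) (u.length + 1) =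
      Nat.findGreatest (fun m => u.take m ∈ trieNodes S) u.length := by
    rw [Nat.findGreatest_of_not (by rwa [List.take_of_length_le (by simp)])]
    obtain ⟨hle, hmem, hmax⟩ := Nat.findGreatest_eq_iff.1
      (Eq.refl (Nat.findGreatest (fun m => u.take m ∈ trieNodes S) u.length))
    refine Nat.findGreatest_eq_iff.2 ⟨hle, fun h0 => ?_, fun m hm hmu => ?_⟩
    · rw [htake _ hle]; exact hmem h0
    · rw [htake _ hmu]; exact hmax hm hmu
  rw [longestMatch, longestMatch, List.length_append, List.length_singleton, hfind,
    htake _ (Nat.findGreatest_le _)]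

/-- The locus of the longest prefix of `u` that is a node of the trie of `S`. Unlike `IsLocus`, this
is a total function of `u`. -/
noncomputable def searchLocus (S : Set (List β)) (u : List β) : List β :=
  Classical.epsilon (IsLocus S (longestMatch S u))

theorem isLocus_searchLocus (hS : ∀ u ∈ trieNodes S, ∃ v, IsLocus S u v)
    (hu : u ∈ trieNodes S) : IsLocus S u (searchLocus S u) := by
  rw [searchLocus, longestMatch_of_mem hu]
  exact Classical.epsilon_spec (hS u hu)

theorem isExplicitNode_searchLocus (hS : ∀ u ∈ trieNodes S, ∃ v, IsLocus S u v)
    (hroot : [] ∈ trieNodes S) (u : List β) : IsExplicitNode S (searchLocus S u) :=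
  (Classical.epsilon_spec (hS _ (longestMatch_mem hroot u))).1

theorem searchLocus_concat (hS : ∀ u ∈ trieNodes S, ∃ v, IsLocus S u v)
    (hne : ¬ IsExplicitNode S u) (c : β) : searchLocus S (u ++ [c]) = searchLocus S u := by
  by_cases hc : u ++ [c] ∈ trieNodes S
  · have hu := mem_trieNodes_of_prefix (List.prefix_append _ _) hc
    exact ((isLocus_searchLocus hS hc).of_child hne hc).unique (isLocus_searchLocus hS hu)
  · rw [searchLocus, searchLocus, longestMatch_concat_of_notMem hc]

end Trie

/-! ## Generalised suffix trees -/

section SuffixTree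

variable {α : Type*} {docs : List (List α)} {x : List α} {u : List (α ⊕ ℕ)}

theorem mem_trieNodes_gstSuffixes_of_cons {a : α ⊕ ℕ}
    (h : a :: u ∈ trieNodes (gstSuffixes docs)) : u ∈ trieNodes (gstSuffixes docs) := by
  obtain ⟨x, ⟨k, w, hk, hx⟩, t, rfl⟩ := h
  exact ⟨u ++ t, ⟨k, w, hk, (List.suffix_cons a (u ++ t)).trans hx⟩, List.prefix_append _ _⟩

theorem length_le_of_mem_trieNodes_gstSuffixes (h : u ∈ trieNodes (gstSuffixes docs)) :
    u.length ≤ (docs.map List.length).sum + 1 := by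
  obtain ⟨x, ⟨k, w, hk, hx⟩, hux⟩ := h
  have hw : w.length ≤ (docs.map List.length).sum :=
    List.le_sum_of_mem (List.mem_map_of_mem (List.mem_of_getElem? hk))
  calc u.length ≤ (plain w ++ [Sum.inr k]).length := hux.length_le.trans hx.length_le
    _ = w.length + 1 := by simp [plain]
    _ ≤ _ := Nat.succ_le_succ hw

theorem exists_isLocus_gstSuffixes (hu : u ∈ trieNodes (gstSuffixes docs)) :
    ∃ v, IsLocus (gstSuffixes docs) u v :=
  exists_isLocus_of_length_le (fun _ => length_le_of_mem_trieNodes_gstSuffixes) hu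

theorem plain_notMem_gstSuffixes (hne : x ≠ []) : plain x ∉ gstSuffixes docs := by
  rintro ⟨k, w, -, s, hs⟩
  have hlast := congrArg List.getLast? hs
  rw [List.getLast?_append_of_ne_nil _ (by simpa [plain] using hne)] at hlast
  simp [plain] at hlast

theorem exists_child_of_plain_mem (hne : x ≠ []) (h : plain x ∈ trieNodes (gstSuffixes docs)) :
    ∃ c, plain x ++ [c] ∈ trieNodes (gstSuffixes docs) := by
  obtain ⟨y, hy, _ | ⟨c, t⟩, rfl⟩ := h
  · exact absurd (by simpa using hy) (plain_notMem_gstSuffixes hne)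
  · exact ⟨c, _, hy, t, by simp⟩

theorem length_le_of_plain_mem (h : plain x ∈ trieNodes (gstSuffixes docs)) :
    x.length ≤ (docs.map List.length).sum := by
  rcases eq_or_ne x [] with rfl | hne
  · exact Nat.zero_le _
  · obtain ⟨c, hc⟩ := exists_child_of_plain_mem hne h
    simpa [plain] using length_le_of_mem_trieNodes_gstSuffixes hc

theorem isExplicitNode_plain_of_cons {a : α}
    (h : IsExplicitNode (gstSuffixes docs) (plain (a :: x))) :
    IsExplicitNode (gstSuffixes docs) (plain x) := by
  obtain ⟨c, hc⟩ := exists_child_of_plain_mem (List.cons_ne_nil a x) h.1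
  exact IsExplicitNode.of_cons (fun _ _ => mem_trieNodes_gstSuffixes_of_cons) h hc

end SuffixTree

/-! ## Windows of a sequence -/

section Window

/-- The string `f i, f (i + 1), ...` of length `m`. -/
def window {G α : Type*} [AddMonoidWithOne G] (f : G → α) (i : G) (m : ℕ) : List α :=
  (List.range m).map fun j : ℕ => f (i + j)

/-- The string of length `m` that ends just before position `c` of the sequence `f`. -/
def windowBefore {G α : Type*} [AddGroupWithOne G] (f : G → α) (c : G) (m : ℕ) : List α :=
  window f (c - m) m

@[simp]
theorem length_window {G α : Type*} [AddMonoidWithOne G] (f : G → α) (i : G) (m : ℕ) :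
    (window f i m).length = m := by
  simp [window]

theorem eq_window_iff {G α : Type*} [AddMonoidWithOne G] {f : G → α} {i : G} {x : List α} :
    x = window f i x.length ↔ ∀ j < x.length, x[j]? = some (f (i + j)) := by
  refine ⟨fun h j hj => ?_, fun h => List.ext_getElem (by simp) fun j hj _ => ?_⟩
  · rw [h, window, List.getElem?_map, List.getElem?_range hj, Option.map_some]
  · simpa [window] using (List.getElem?_eq_some_iff.1 (h j hj)).2

theorem eq_of_window_eq {G α : Type*} [AddMonoidWithOne G] {f : G → α} {i i' : G} {j m : ℕ}
    (h : window f i m = window f i' m) (hj : j < m) : f (i + j) = f (i' + j) :=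
  List.map_inj_left.1 h j (List.mem_range.2 hj)

variable {G α : Type*} [AddGroupWithOne G] (f : G → α)

@[simp]
theorem length_windowBefore (c : G) (m : ℕ) : (windowBefore f c m).length = m :=
  length_window _ _ _

theorem windowBefore_succ (c : G) (m : ℕ) :
    windowBefore f c (m + 1) = f (c - (m + 1)) :: windowBefore f c m := by
  simp only [windowBefore, window, List.range_succ_eq_map, List.map_cons, List.map_map]
  congr 1
  · simp
  · refine List.map_congr_left fun j _ => congrArg f ?_
    rw [Nat.add_comm m 1, Nat.succ_eq_one_add, Nat.cast_add, Nat.cast_add, sub_add_eq_sub_sub_swap,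
      ← add_assoc, Nat.cast_one, sub_add_cancel]

theorem windowBefore_add_one (c : G) (m : ℕ) :
    windowBefore f (c + 1) (m + 1) = windowBefore f c m ++ [f c] := by
  simp [windowBefore, window, List.range_succ]

theorem windowBefore_add_natCast (i : G) (m : ℕ) : windowBefore f (i + m) m = window f i m := by
  rw [windowBefore, add_sub_cancel_right]

end Window

/-! ## Infinite powers of a string -/

section InfPow

variable {α : Type*} {r : List α}

/-- The infinite power `r r r ...` of a nonempty string. As it is periodic, its positions are taken
modulo `|r|`, so that it also extends to the left. -/
def infPow (r : List α) [NeZero r.length] (c : ZMod r.length) : α :=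
  r[c.val]'c.val_lt

theorem infPow_natCast [NeZero r.length] {j : ℕ} :
    r[j % r.length]? = some (infPow r j) := by
  rw [infPow, List.getElem?_eq_some_iff]
  exact ⟨Nat.mod_lt _ (NeZero.pos _), by simp only [ZMod.val_natCast]⟩

theorem getElem?_eq_some_infPow [NeZero r.length] {j : ℕ} (hj : j < r.length) :
    r[j]? = some (infPow r j) := by
  rw [← infPow_natCast, Nat.mod_eq_of_lt hj]

theorem occursInPowAt_iff_eq_window [NeZero r.length] {i : ℕ} {x : List α} :
    OccursInPowAt r i x ↔ x = window (infPow r) i x.length := by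
  simp only [eq_window_iff, OccursInPowAt, infPow_natCast, Nat.cast_add]

theorem getElem?_strPow (v : List α) (m : ℕ) {j : ℕ} (hj : j < m * v.length) :
    (strPow v m)[j]? = v[j % v.length]? := by
  induction m generalizing j with
  | zero => simp at hj
  | succ m ih =>
    rw [strPow, List.replicate_succ, List.flatten_cons]
    by_cases h : j < v.length
    · rw [List.getElem?_append_left h, Nat.mod_eq_of_lt h]
    · rw [Nat.succ_mul] at hj
      rw [List.getElem?_append_right (by omega), ← strPow, ih (by omega),
        ← Nat.mod_eq_sub_mod (by omega)]

theorem length_strPow (v : List α) (m : ℕ) : (strPow v m).length = m * v.length := by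
  simp [strPow]

theorem eq_strPow_take {g m : ℕ} (hlen : r.length = m * g) (hg : g ≤ r.length)
    (h : ∀ j < r.length, r[j]? = r[j % g]?) : r = strPow (r.take g) m := by
  have htake : (r.take g).length = g := by simpa using hg
  have hpow : (strPow (r.take g) m).length = r.length := by rw [length_strPow, htake, hlen]
  refine List.ext_getElem? fun j => ?_
  rcases lt_or_ge j r.length with hj | hj
  · have hgpos : 0 < g := Nat.pos_of_ne_zero fun h0 => by simp [hlen, h0] at hj
    rw [getElem?_strPow _ _ (by rwa [htake, ← hlen]), htake,
      List.getElem?_take_of_lt (Nat.mod_lt _ hgpos), h j hj]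
  · rw [List.getElem?_eq_none hj, List.getElem?_eq_none (hpow.trans_le hj)]

theorem IsPrimitive.neZero_length (h : IsPrimitive r) : NeZero r.length := by
  refine ⟨fun h0 => h [] 2 one_lt_two ?_⟩
  simpa [strPow] using h0

theorem IsPrimitive.eq_zero_of_periodic [NeZero r.length] (h : IsPrimitive r) {d : ZMod r.length}
    (hd : Function.Periodic (infPow r) d) : d = 0 := by
  set g := Nat.gcd d.val r.length
  obtain ⟨m, hm⟩ : g ∣ r.length := Nat.gcd_dvd_right _ _
  have hgd : (g : ZMod r.length) = Nat.gcdA d.val r.length * d := by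
    have := congrArg (Int.cast (R := ZMod r.length)) (Nat.gcd_eq_gcd_ab d.val r.length)
    simpa [mul_comm] using this
  have hg : Function.Periodic (infPow r) g := hgd ▸ hd.int_mul _
  have hr : r = strPow (r.take g) m := by
    refine eq_strPow_take (hm.trans (mul_comm _ _)) (Nat.gcd_le_right _ (NeZero.pos _))
      fun j hj => ?_
    have := hg.nat_mul (j / g) (j % g : ℕ)
    rw [← Nat.cast_mul, ← Nat.cast_add, mul_comm, Nat.mod_add_div] at this
    rw [getElem?_eq_some_infPow hj, this,
      ← getElem?_eq_some_infPow ((Nat.mod_le _ _).trans_lt hj)]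
  have hm1 : m = 1 := by
    have hm0 : m ≠ 0 := fun h0 => NeZero.ne r.length (by rw [hm, h0, mul_zero])
    have : ¬ 1 < m := fun h1 => h _ _ h1 hr
    omega
  have hdvd : r.length ∣ d.val := by
    rw [hm1, mul_one] at hm
    exact hm.dvd.trans (Nat.gcd_dvd_left _ _)
  rwa [← ZMod.natCast_eq_zero_iff, ZMod.natCast_zmod_val] at hdvd

theorem IsPrimitive.eq_of_window_eq [NeZero r.length] (h : IsPrimitive r) {i i' : ZMod r.length}
    {m : ℕ} (hm : r.length ≤ m) (heq : window (infPow r) i m = window (infPow r) i' m) :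
    i = i' := by
  refine (sub_eq_zero.1 (h.eq_zero_of_periodic fun c => ?_)).symm
  have := _root_.eq_of_window_eq heq ((c - i).val_lt.trans_le hm)
  rw [ZMod.natCast_zmod_val, add_sub_cancel] at this
  rw [this]
  congr 1
  abel

end InfPow

/-! ## Explicit nodes along an infinite power -/

section ExplicitHeight

variable {α : Type*} (docs : List (List α)) {r : List α} [NeZero r.length] (B : ℕ)

/-- The number of explicit nodes among the strings of length at least `B` that end just before
position `c` of the infinite power of `r`; these are the nodes of the lengths `B`, `B + 1`, ...,
because suffixes of explicit nodes are explicit. -/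
noncomputable def explicitHeight (r : List α) [NeZero r.length] (c : ZMod r.length) : ℕ :=
  sInf {y | ¬ IsExplicitNode (gstSuffixes docs) (plain (windowBefore (infPow r) c (B + y)))}

variable {docs B}

theorem IsExplicitNode.plain_windowBefore_of_le {c : ZMod r.length} {m m' : ℕ} (hm : m ≤ m')
    (h : IsExplicitNode (gstSuffixes docs) (plain (windowBefore (infPow r) c m'))) :
    IsExplicitNode (gstSuffixes docs) (plain (windowBefore (infPow r) c m)) := by
  induction hm with
  | refl => exact h
  | step _ ih => exact ih (isExplicitNode_plain_of_cons (windowBefore_succ (infPow r) c _ ▸ h))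

theorem isExplicitNode_plain_windowBefore_iff {c : ZMod r.length} {y : ℕ} :
    IsExplicitNode (gstSuffixes docs) (plain (windowBefore (infPow r) c (B + y))) ↔
      y < explicitHeight docs B r c := by
  refine ⟨fun h => ?_, fun h => not_not.1 (Nat.notMem_of_lt_sInf h)⟩
  set T := {y | ¬ IsExplicitNode (gstSuffixes docs) (plain (windowBefore (infPow r) c (B + y)))}
  have hT : (docs.map List.length).sum + 1 ∈ T := fun he => by
    have := length_le_of_plain_mem he.1
    rw [length_windowBefore] at this
    omega
  by_contra hle
  exact Nat.sInf_mem ⟨_, hT⟩ (h.plain_windowBefore_of_le (Nat.add_le_add_left (not_lt.1 hle) B))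

theorem explicitHeight_le (c : ZMod r.length) :
    explicitHeight docs B r c ≤ (docs.map List.length).sum + 1 := by
  by_contra hlt
  have h := isExplicitNode_plain_windowBefore_iff.2 (not_le.1 hlt)
  have := length_le_of_plain_mem h.1
  rw [length_windowBefore] at this
  omega

theorem finite_periodicPart (docs : List (List α)) (r : List α) [NeZero r.length] (ℓ : ℕ) :
    (periodicPart docs r ℓ).Finite := by
  refine ((Set.finite_univ.prod (Set.finite_Iic (docs.map List.length).sum)).image
    fun q : ZMod r.length × ℕ => plain (window (infPow r) q.1 q.2)).subset ?_
  rintro _ ⟨hu, x, i, rfl, hx, -⟩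
  exact ⟨(i, x.length), ⟨Set.mem_univ _, length_le_of_plain_mem hu⟩,
    congrArg plain (occursInPowAt_iff_eq_window.1 hx).symm⟩

theorem plain_window_mem_periodicPart {c : ZMod r.length} {m ℓ : ℕ} (hm : ℓ ≤ 2 * m)
    (h : plain (window (infPow r) c m) ∈ trieNodes (gstSuffixes docs)) :
    plain (window (infPow r) c m) ∈ periodicPart docs r ℓ := by
  refine ⟨h, _, c.val, rfl, occursInPowAt_iff_eq_window.2 ?_, by rwa [length_window]⟩
  rw [length_window, ZMod.natCast_zmod_val]

theorem sum_explicitHeight_le (hprim : IsPrimitive r) {ℓ : ℕ} (hℓ : ℓ ≤ 2 * B)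
    (hB : r.length ≤ B) : ∑ c, explicitHeight docs B r c ≤ numExplicitPeriodic docs r ℓ := by
  classical
  let P : Finset (Σ _ : ZMod r.length, ℕ) :=
    Finset.univ.sigma fun c => Finset.range (explicitHeight docs B r c)
  have hP : ∀ q ∈ P, IsExplicitNode (gstSuffixes docs)
      (plain (windowBefore (infPow r) q.1 (B + q.2))) := fun q hq =>
    isExplicitNode_plain_windowBefore_iff.2 (by simpa [P] using hq)
  calc ∑ c, explicitHeight docs B r c = (P : Set (Σ _ : ZMod r.length, ℕ)).ncard := by
        rw [Set.ncard_coe_finset]; simp [P, Finset.card_sigma]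
    _ ≤ numExplicitPeriodic docs r ℓ := ?_
  refine Set.ncard_le_ncard_of_injOn
    (fun q => plain (windowBefore (infPow r) q.1 (B + q.2))) (fun q hq => ?_) ?_
    ((finite_periodicPart docs r ℓ).subset (Set.sep_subset _ _))
  · exact ⟨plain_window_mem_periodicPart (by omega) (hP q hq).1, hP q hq⟩
  · rintro ⟨c, y⟩ - ⟨c', y'⟩ - heq
    have heq : windowBefore (infPow r) c (B + y) = windowBefore (infPow r) c' (B + y') :=
      List.map_injective_iff.2 Sum.inl_injective heq
    obtain rfl : y = y' := by simpa using congrArg List.length heq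
    have hc := hprim.eq_of_window_eq (by omega) heq
    rw [sub_left_inj] at hc
    rw [hc]

end ExplicitHeight

namespace WordRAM

/-! ## A lookup table for the word RAM -/

section Memory

theorem memOf_append_left {L L' : List ℕ} {a : ℕ} (h : a < L.length) :
    memOf (L ++ L') a = memOf L a := by
  simp only [memOf, List.getD_eq_getElem?_getD, List.getElem?_append_left h]

theorem memOf_append_right (L L' : List ℕ) (a : ℕ) :
    memOf (L ++ L') (L.length + a) = memOf L' a := by
  simp [memOf, List.getD_eq_getElem?_getD, List.getElem?_append_right]

theorem memOf_map_range (f : ℕ → ℕ) {n a : ℕ} (h : a < n) :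
    memOf ((List.range n).map f) a = f a := by
  simp [memOf, List.getD_eq_getElem?_getD, h]

theorem length_flatMap_map_range (f : ℕ → ℕ → ℕ) (len : ℕ → ℕ) (p : ℕ) :
    ((List.range p).flatMap fun c => (List.range (len c)).map (f c)).length =
      ∑ c ∈ Finset.range p, len c := by
  simp only [List.length_flatMap, List.length_map, List.length_range]
  rfl

theorem memOf_flatMap_map_range (f : ℕ → ℕ → ℕ) (len : ℕ → ℕ) {p c y : ℕ} (hc : c < p)
    (hy : y < len c) :
    memOf ((List.range p).flatMap fun c => (List.range (len c)).map (f c))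
      (∑ j ∈ Finset.range c, len j + y) = f c y := by
  have hsum : ∑ j ∈ Finset.range c, len j =
      ((List.range c).flatMap fun c => (List.range (len c)).map (f c)).length :=
    (length_flatMap_map_range f len c).symm
  obtain ⟨q, rfl⟩ := Nat.exists_eq_add_of_lt hc
  rw [hsum, add_assoc, List.range_add, List.flatMap_append, memOf_append_right,
    List.range_succ_eq_map, List.map_cons, List.flatMap_cons, add_zero,
    memOf_append_left (by simpa using hy), memOf_map_range _ hy]

end Memory

/-- The content of a table that answers queries `(i, m)` with `i < period` about the string of
length `m` that starts at position `i` of an infinite power of period `period`. With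
`y = m - minLength`, the answer for `maxHeight ≤ y` is `deepAnswer i`. Otherwise `blockEntry` gives,
at an index that depends only on `(i + m) % period` and `y / period`, a memory address to which `y`
has to be added. The query is tagged by 1 if `height ((i + m) % period) ≤ y`, and by 0 otherwise. -/
structure LookupTable where
  (period minLength maxHeight numBlockEntries : ℕ)
  (height deepAnswer blockEntry : ℕ → ℕ)
  (data : List ℕ)

namespace LookupTable

/-- The memory image of a table. The fourth word is the address of the block entries. -/
def image (T : LookupTable) : List ℕ :=
  [T.period, T.minLength, T.maxHeight, 4 + 2 * T.period] ++
    ((List.range T.period).map T.height ++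
      ((List.range T.period).map T.deepAnswer ++
        ((List.range T.numBlockEntries).map T.blockEntry ++ T.data)))

variable {T : LookupTable} {a : ℕ}

theorem length_image (T : LookupTable) :
    T.image.length = 4 + 2 * T.period + T.numBlockEntries + T.data.length := by
  simp only [image, List.length_append, List.length_cons, List.length_nil, List.length_map,
    List.length_range]
  omega

theorem memOf_image_height (ha : a < T.period) : memOf T.image (a + 4) = T.height a := by
  rw [add_comm, image]
  refine (memOf_append_right [_, _, _, _] _ a).trans ?_
  rw [memOf_append_left (by simpa using ha), memOf_map_range _ ha]

theorem memOf_image_deepAnswer (ha : a < T.period) :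
    memOf T.image (a + T.period + 4) = T.deepAnswer a := by
  have : a + T.period + 4 = 4 + (((List.range T.period).map T.height).length + a) := by
    simp only [List.length_map, List.length_range]; omega
  rw [this, image]
  refine (memOf_append_right [_, _, _, _] _ _).trans ?_
  rw [memOf_append_right, memOf_append_left (by simpa using ha), memOf_map_range _ ha]

theorem memOf_image_add (T : LookupTable) (a : ℕ) :
    memOf T.image (4 + 2 * T.period + a) =
      memOf ((List.range T.numBlockEntries).map T.blockEntry ++ T.data) a := by
  have : 4 + 2 * T.period + a = 4 + (((List.range T.period).map T.height).length +
      (((List.range T.period).map T.deepAnswer).length + a)) := by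
    simp only [List.length_map, List.length_range]; omega
  rw [this, image]
  refine (memOf_append_right [_, _, _, _] _ _).trans ?_
  rw [memOf_append_right, memOf_append_right]

theorem memOf_image_blockEntry (ha : a < T.numBlockEntries) :
    memOf T.image (a + (4 + 2 * T.period)) = T.blockEntry a := by
  rw [add_comm, memOf_image_add, memOf_append_left (by simpa using ha), memOf_map_range _ ha]

theorem memOf_image_data (T : LookupTable) (a : ℕ) :
    memOf T.image (4 + 2 * T.period + T.numBlockEntries + a) = memOf T.data a := by
  rw [add_assoc, memOf_image_add]
  simpa using memOf_append_right ((List.range T.numBlockEntries).map T.blockEntry) T.data a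

end LookupTable

/-- The program that evaluates a lookup table. It puts `period` into register 2, `m - minLength`
into register 5, `(i + m) % period` into register 6, the tag into register 1 and the address of the
answer into register 10; register 20 is never written to and contains 0. -/
def lookupProgram : Program :=
  [.load 2 20, .const 3 1, .load 4 3, .op .sub 5 1 4, .op .add 6 0 1, .op .mod 6 6 2,
   .const 8 4, .op .add 7 6 8, .load 7 7, .op .lt 9 5 7, .op .eq 1 9 20,
   .op .div 10 5 2, .const 3 2, .load 11 3, .op .lt 12 5 11, .jumpZero 12 24,
   .op .mul 10 10 2, .op .add 10 10 6, .const 3 3, .load 11 3, .op .add 10 10 11, .load 10 10,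
   .op .add 10 10 5, .jump 26,
   .op .add 10 0 2, .op .add 10 10 8,
   .load 0 10, .halt]

theorem eval_sub {W x y : ℕ} (hyx : y ≤ x) (hx : x < 2 ^ W) : BinOp.eval W .sub x y = x - y := by
  rw [BinOp.eval, Nat.mod_eq_of_lt (hyx.trans_lt hx), ← Nat.add_sub_assoc (hyx.trans_lt hx).le,
    Nat.sub_add_comm hyx, Nat.add_mod_right, Nat.mod_eq_of_lt ((Nat.sub_le _ _).trans_lt hx)]

theorem run_add (W : ℕ) (P : Program) (s t : ℕ) (σ : Config) :
    run W P (s + t) σ = run W P t (run W P s σ) := by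
  rw [add_comm]
  exact Function.iterate_add_apply _ _ _ _

section LookupProgram

variable {W : ℕ} {T : LookupTable} {i m : ℕ}

/-- The computation up to the conditional jump. -/
theorem exists_run_lookupProgram (hW : T.image.length < 2 ^ W) (hi : i < T.period)
    (hB : T.minLength ≤ m) (him : i + m < 2 ^ W) :
    ∃ reg : ℕ → ℕ, run W lookupProgram 15 (start T.image i m) = ⟨15, reg, memOf T.image⟩ ∧
      reg 0 = i ∧
      reg 1 = (if T.height ((i + m) % T.period) ≤ m - T.minLength then 1 else 0) ∧
      reg 2 = T.period ∧ reg 5 = m - T.minLength ∧ reg 6 = (i + m) % T.period ∧ reg 8 = 4 ∧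
      reg 10 = (m - T.minLength) / T.period ∧
      reg 12 = if m - T.minLength < T.maxHeight then 1 else 0 := by
  rw [T.length_image] at hW
  have hc : (i + m) % T.period < T.period := Nat.mod_lt _ (by omega)
  have hdiv : (m - T.minLength) / T.period ≤ m := (Nat.div_le_self _ _).trans (Nat.sub_le _ _)
  have hmem0 : memOf T.image 0 = T.period := rfl
  have hmem1 : memOf T.image 1 = T.minLength := rfl
  have hmem2 : memOf T.image 2 = T.maxHeight := rfl
  have e1 : 1 % 2 ^ W = 1 := Nat.mod_eq_of_lt (by omega)
  have e2 : 2 % 2 ^ W = 2 := Nat.mod_eq_of_lt (by omega)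
  have e4 : 4 % 2 ^ W = 4 := Nat.mod_eq_of_lt (by omega)
  have hbool (q : Prop) [Decidable q] : (if q then 1 else 0) % 2 ^ W = if q then 1 else 0 := by
    split_ifs <;> simp [e1]
  have hsub := eval_sub hB (by omega : m < 2 ^ W)
  have hadd := Nat.mod_eq_of_lt him
  have hmod := Nat.mod_eq_of_lt (by omega : (i + m) % T.period < 2 ^ W)
  have haddr := Nat.mod_eq_of_lt (by omega : (i + m) % T.period + 4 < 2 ^ W)
  have hdivW := Nat.mod_eq_of_lt (by omega : (m - T.minLength) / T.period < 2 ^ W)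
  have hheight := T.memOf_image_height hc
  rw [BinOp.eval] at hsub
  refine ⟨(run W lookupProgram 15 (start T.image i m)).reg, ?_⟩
  simp [run, start, step, lookupProgram, BinOp.eval, hmem0, hmem1, hmem2, e1, e2, e4, hbool, hsub,
    hadd, hmod, haddr, hdivW, hheight]

theorem lookupProgram_answersWithin_of_lt (hW : T.image.length < 2 ^ W) (hi : i < T.period)
    (hB : T.minLength ≤ m) (him : i + m < 2 ^ W) (hm : m - T.minLength < T.maxHeight) {a : ℕ}
    (ha : (m - T.minLength) / T.period * T.period + (i + m) % T.period = a)
    (hlt : a < T.numBlockEntries) (hadd : T.blockEntry a + (m - T.minLength) < 2 ^ W) :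
    AnswersWithin W lookupProgram 25 T.image i m
      (memOf T.image (T.blockEntry a + (m - T.minLength)))
      (if T.height ((i + m) % T.period) ≤ m - T.minLength then 1 else 0) := by
  obtain ⟨reg, hrun, -, h1, h2, h5, h6, -, h10, h12⟩ := exists_run_lookupProgram hW hi hB him
  rw [if_pos hm] at h12
  rw [T.length_image] at hW
  have hmem3 : memOf T.image 3 = 4 + 2 * T.period := rfl
  have e3 : 3 % 2 ^ W = 3 := Nat.mod_eq_of_lt (by omega)
  have hmul := Nat.mod_eq_of_lt
    (by omega : (m - T.minLength) / T.period * T.period < 2 ^ W)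
  have haW := Nat.mod_eq_of_lt (by omega : a < 2 ^ W)
  have haddr := Nat.mod_eq_of_lt (by omega : a + (4 + 2 * T.period) < 2 ^ W)
  have hentry := T.memOf_image_blockEntry hlt
  have haddW := Nat.mod_eq_of_lt hadd
  refine ⟨15 + 10, le_rfl, ?_⟩
  rw [run_add, hrun]
  simp [Halted, run, step, lookupProgram, BinOp.eval, h1, h2, h5, h6, h10, h12, hmem3, e3, hmul,
    ha, haW, haddr, hentry, haddW]

theorem lookupProgram_answersWithin_of_le (hW : T.image.length < 2 ^ W) (hi : i < T.period)
    (hB : T.minLength ≤ m) (him : i + m < 2 ^ W) (hm : T.maxHeight ≤ m - T.minLength) :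
    AnswersWithin W lookupProgram 25 T.image i m (T.deepAnswer i)
      (if T.height ((i + m) % T.period) ≤ m - T.minLength then 1 else 0) := by
  obtain ⟨reg, hrun, h0, h1, h2, -, -, h8, -, h12⟩ := exists_run_lookupProgram hW hi hB him
  rw [if_neg hm.not_gt] at h12
  rw [T.length_image] at hW
  have hadd := Nat.mod_eq_of_lt (by omega : i + T.period < 2 ^ W)
  have haddr := Nat.mod_eq_of_lt (by omega : i + T.period + 4 < 2 ^ W)
  have hanswer := T.memOf_image_deepAnswer hi
  refine ⟨15 + 4, by norm_num, ?_⟩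
  rw [run_add, hrun]
  simp [Halted, run, step, lookupProgram, BinOp.eval, h0, h1, h2, h8, h12, hadd, haddr, hanswer]

end LookupProgram

/-! ## The table of an eventually diagonal function -/

section PeriodicTable

variable {p : ℕ} {h : ZMod p → ℕ} {A : ZMod p → ℕ → ℕ}

theorem apply_eq_apply_add (hA : ∀ c y, h c ≤ y → A c y = A (c + 1) (y + 1)) {c : ZMod p}
    {y k : ℕ} (hk : ∀ j < k, h (c + j) ≤ y + j) : A c y = A (c + k) (y + k) := by
  induction k with
  | zero => simp
  | succ k ih =>
    rw [ih fun j hj => hk j (hj.trans k.lt_succ_self), hA _ _ (hk k k.lt_succ_self)]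
    push_cast
    rw [add_assoc, add_assoc]

/-- The distance from column `c` to the next column that is higher than `t`. It is meaningful only
if there is such a column. -/
noncomputable def nextAbove (h : ZMod p → ℕ) (c : ZMod p) (t : ℕ) : ℕ :=
  sInf {k : ℕ | t < h (c + k)}

theorem apply_add_le_of_lt_nextAbove {c : ZMod p} {t j : ℕ} (hj : j < nextAbove h c t) :
    h (c + j) ≤ t :=
  not_lt.1 (Nat.notMem_of_lt_sInf (s := {k : ℕ | t < h (c + k)}) hj)

/-- The position in the data of `periodicTable` at which the row of `c` starts. -/
def rowStart (h : ZMod p → ℕ) (c : ZMod p) : ℕ :=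
  ∑ j ∈ Finset.range c.val, 3 * h j

variable [NeZero p]

theorem nextAbove_lt (c : ZMod p) (t : ℕ) : nextAbove h c t < p := by
  rcases Set.eq_empty_or_nonempty {k : ℕ | t < h (c + k)} with hempty | ⟨k, hk⟩
  · rw [nextAbove, hempty, Nat.sInf_empty]
    exact NeZero.pos p
  · refine (Nat.sInf_le (m := k % p) ?_).trans_lt (Nat.mod_lt _ (NeZero.pos p))
    rwa [Set.mem_ofPred_eq, ZMod.natCast_mod]

theorem lt_apply_add_nextAbove {c₀ : ZMod p} {t : ℕ} (ht : t < h c₀) (c : ZMod p) :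
    t < h (c + nextAbove h c t) := by
  refine Nat.sInf_mem (s := {k : ℕ | t < h (c + k)}) ⟨(c₀ - c).val, ?_⟩
  rwa [Set.mem_ofPred_eq, ZMod.natCast_zmod_val, add_sub_cancel]

variable (h A) (B : ℕ)

/-- The number of block entries of `periodicTable`: there is one block of `p` entries for each
interval of length `p` that is not above the highest column. -/
noncomputable def numEntries : ℕ :=
  (Finset.univ.sup h / p + 1) * p

/-- A table for a function `A` that is constant on diagonals above the columns `h`, that is,
`A c y = A (c + 1) (y + 1)` for `h c ≤ y`. The data consists of the values `A c y` for
`y < 3 * h c`. The entry for column `c` and block `b` points to the row of the next column that is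
higher than `b * p`, which the diagonals through the points `(c, y)` of block `b` run into. As
rows are three times as high as columns, all these diagonals, except those of the block 0, meet the
row at a stored value. -/
noncomputable def periodicTable : LookupTable where
  period := p
  minLength := B
  maxHeight := Finset.univ.sup h
  numBlockEntries := numEntries h
  height a := h a
  deepAnswer i := A (i + B + (Finset.univ.sup h : ℕ)) (Finset.univ.sup h)
  blockEntry a :=
    let k := nextAbove h a (a / p * p)
    4 + 2 * p + numEntries h + (rowStart h (a + k) + k)
  data := (List.range p).flatMap fun c : ℕ => (List.range (3 * h c)).map (A c)

variable {h A B}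

theorem sum_range_natCast (g : ZMod p → ℕ) : ∑ j ∈ Finset.range p, g j = ∑ c, g c :=
  Finset.sum_nbij' (fun j => j) ZMod.val (by simp) (by simp [ZMod.val_lt])
    (fun j hj => ZMod.val_natCast_of_lt (Finset.mem_range.1 hj)) (by simp) (by simp)

theorem sup_le_sum : Finset.univ.sup h ≤ ∑ c, h c :=
  Finset.sup_le fun c _ => Finset.single_le_sum_of_canonicallyOrdered (Finset.mem_univ c)

theorem numEntries_le : numEntries h ≤ ∑ c, h c + p := by
  rw [numEntries, Nat.succ_mul]
  exact Nat.add_le_add_right ((Nat.div_mul_le_self _ _).trans sup_le_sum) p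

theorem rowStart_le (c : ZMod p) : rowStart h c ≤ 3 * ∑ c, h c := by
  rw [rowStart, ← Finset.mul_sum, ← sum_range_natCast h]
  gcongr
  exact c.val_lt.le

theorem memOf_data_periodicTable {c : ZMod p} {y : ℕ} (hy : y < 3 * h c) :
    memOf (periodicTable h A B).data (rowStart h c + y) = A c y := by
  have := memOf_flatMap_map_range (fun c : ℕ => A c) (fun c : ℕ => 3 * h c) c.val_lt
    (y := y) (by simpa using hy)
  rw [ZMod.natCast_zmod_val] at this
  exact this

theorem length_periodicTable_image_le :
    (periodicTable h A B).image.length ≤ 4 + 3 * p + 4 * ∑ c, h c := by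
  have hdata : (periodicTable h A B).data.length = 3 * ∑ c, h c := by
    rw [Finset.mul_sum, ← sum_range_natCast fun c => 3 * h c]
    exact length_flatMap_map_range _ _ _
  have := numEntries_le (h := h)
  rw [LookupTable.length_image, hdata]
  simp only [periodicTable]
  omega

theorem blockEntry_periodicTable_lt (a : ℕ) :
    (periodicTable h A B).blockEntry a < 4 + 4 * p + 4 * ∑ c, h c := by
  have := numEntries_le (h := h)
  have := nextAbove_lt (h := h) a (a / p * p)
  have := rowStart_le (h := h) (a + nextAbove h a (a / p * p))
  simp only [periodicTable]
  omega

theorem lt_of_mem_periodicTable_image {N : ℕ} (hA : ∀ c y, A c y < N) (hB : B < N)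
    (hN : 4 + 4 * p + 4 * ∑ c, h c < N) : ∀ a ∈ (periodicTable h A B).image, a < N := by
  have hsup := sup_le_sum (h := h)
  have hmax : ∀ c, h c ≤ Finset.univ.sup h := fun c => Finset.le_sup (Finset.mem_univ c)
  simp only [LookupTable.image, periodicTable, List.forall_mem_append, List.forall_mem_cons,
    List.forall_mem_map, List.mem_flatMap]
  refine ⟨⟨by omega, hB, by omega, by omega, by simp⟩,
    fun c _ => ((hmax c).trans hsup).trans_lt (by omega), fun _ _ => hA _ _,
    fun b _ => (blockEntry_periodicTable_lt (A := A) (B := B) b).trans hN, ?_⟩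
  rintro _ ⟨c, -, ha⟩
  obtain ⟨y, -, rfl⟩ := List.mem_map.1 ha
  exact hA _ _

theorem memOf_periodicTable_blockEntry (hA : ∀ c y, h c ≤ y → A c y = A (c + 1) (y + 1))
    (c : ℕ) {y : ℕ} (hpy : p ≤ y) (hy : y < Finset.univ.sup h) (hc : c < p) :
    memOf (periodicTable h A B).image ((periodicTable h A B).blockEntry (y / p * p + c) + y) =
      A c y := by
  have hblock : (y / p * p + c) / p * p = y / p * p := by
    rw [add_comm, Nat.add_mul_div_right _ _ (NeZero.pos p), Nat.div_eq_of_lt hc, zero_add]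
  have hcast : ((y / p * p + c : ℕ) : ZMod p) = c := by simp
  obtain ⟨c₀, -, hc₀⟩ := Finset.lt_sup_iff.1 hy
  have hty : y / p * p ≤ y := Nat.div_mul_le_self _ _
  set k := nextAbove h c (y / p * p) with hk
  have hkp : k < p := nextAbove_lt _ _
  have hlt : y / p * p < h (c + k) := lt_apply_add_nextAbove (hty.trans_lt hc₀) c
  have hrow : y + k < 3 * h (c + k) := by
    have hp : p ≤ y / p * p := Nat.le_mul_of_pos_left p (Nat.div_pos hpy (NeZero.pos p))
    have := Nat.lt_div_mul_add (NeZero.pos p) (a := y)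
    omega
  calc memOf (periodicTable h A B).image ((periodicTable h A B).blockEntry (y / p * p + c) + y)
      = memOf (periodicTable h A B).image
          (4 + 2 * p + numEntries h + (rowStart h (c + k) + (y + k))) := by
        simp only [periodicTable, hblock, hcast, ← hk]
        congr 1
        omega
    _ = A (c + k) (y + k) :=
        (LookupTable.memOf_image_data _ _).trans (memOf_data_periodicTable hrow)
    _ = A c y := (apply_eq_apply_add hA fun j hj =>
        (apply_add_le_of_lt_nextAbove hj).trans (hty.trans (Nat.le_add_right y j))).symm

theorem periodicTable_answersWithin {W i m : ℕ}
    (hA : ∀ c y, h c ≤ y → A c y = A (c + 1) (y + 1)) (hW : 4 + 4 * p + 5 * ∑ c, h c < 2 ^ W)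
    (hi : i < p) (hm : B + p ≤ m) (him : i + m < 2 ^ W) :
    AnswersWithin W lookupProgram 25 (periodicTable h A B).image i m (A (i + m) (m - B))
      (if h (i + m) ≤ m - B then 1 else 0) := by
  have hlen : (periodicTable h A B).image.length < 2 ^ W :=
    length_periodicTable_image_le.trans_lt (by omega)
  have hBm : B ≤ m := (Nat.le_add_right B p).trans hm
  have hheight : (periodicTable h A B).height ((i + m) % p) = h (i + m) := by
    simp [periodicTable]
  rw [← hheight]
  rcases lt_or_ge (m - B) (Finset.univ.sup h) with hlt | hle
  · have hc : (i + m) % p < p := Nat.mod_lt _ (NeZero.pos p)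
    have hcast : (((i + m) % p : ℕ) : ZMod p) = i + m := by simp
    have hindex : (m - B) / p * p + (i + m) % p < numEntries h := by
      rw [numEntries, Nat.succ_mul]
      exact add_lt_add_of_le_of_lt (by gcongr) hc
    have hadd : (periodicTable h A B).blockEntry ((m - B) / p * p + (i + m) % p) + (m - B) <
        2 ^ W := by
      have := blockEntry_periodicTable_lt (h := h) (A := A) (B := B)
        ((m - B) / p * p + (i + m) % p)
      have := hlt.trans_le sup_le_sum
      omega
    rw [← hcast, ← memOf_periodicTable_blockEntry hA _ (by omega) hlt hc]
    exact lookupProgram_answersWithin_of_lt hlen hi hBm him hlt rfl hindex hadd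
  · have hdeep : A (i + m) (m - B) = (periodicTable h A B).deepAnswer i := by
      have hM : ∀ c, h c ≤ Finset.univ.sup h := fun c => Finset.le_sup (Finset.mem_univ c)
      obtain ⟨k, hk⟩ := Nat.exists_eq_add_of_le hle
      obtain rfl : m = B + (Finset.univ.sup h + k) := by omega
      rw [hk]
      simp only [periodicTable]
      rw [apply_eq_apply_add (k := k) hA fun j _ => (hM _).trans (Nat.le_add_right _ j)]
      push_cast
      simp only [add_assoc]
    rw [hdeep]
    exact lookupProgram_answersWithin_of_le hlen hi hBm him hle

end PeriodicTable

end WordRAM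

/-! ## The data structure -/

section PeriodicLocus

variable {α : Type*} {docs : List (List α)} {r : List α} [NeZero r.length] {B : ℕ}

/-- The node at which the search for the string of length `B + y` that ends just before position `c`
of the infinite power of `r` ends, or the lower endpoint of the edge on which it ends. -/
noncomputable def periodicLocus (docs : List (List α)) (B : ℕ) (r : List α) [NeZero r.length]
    (c : ZMod r.length) (y : ℕ) : List (α ⊕ ℕ) :=
  searchLocus (gstSuffixes docs) (plain (windowBefore (infPow r) c (B + y)))

theorem periodicLocus_add_one {c : ZMod r.length} {y : ℕ} (hy : explicitHeight docs B r c ≤ y) :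
    periodicLocus docs B r c y = periodicLocus docs B r (c + 1) (y + 1) := by
  have hplain : plain (windowBefore (infPow r) (c + 1) (B + (y + 1))) =
      plain (windowBefore (infPow r) c (B + y)) ++ [Sum.inl (infPow r c)] := by
    rw [← add_assoc, windowBefore_add_one]
    simp [plain]
  rw [periodicLocus, periodicLocus, hplain]
  exact (searchLocus_concat (fun _ => exists_isLocus_gstSuffixes)
    (isExplicitNode_plain_windowBefore_iff.not.2 hy.not_gt) _).symm

theorem isExplicitNode_periodicLocus (hroot : [] ∈ trieNodes (gstSuffixes docs))
    (c : ZMod r.length) (y : ℕ) :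
    IsExplicitNode (gstSuffixes docs) (periodicLocus docs B r c y) :=
  isExplicitNode_searchLocus (fun _ => exists_isLocus_gstSuffixes) hroot _

theorem OccursInPowAt.eq_windowBefore {i : ℕ} {x : List α} (hx : OccursInPowAt r i x)
    (hB : B ≤ x.length) :
    x = windowBefore (infPow r) (i + x.length) (B + (x.length - B)) := by
  rw [Nat.add_sub_cancel' hB, windowBefore_add_natCast]
  exact occursInPowAt_iff_eq_window.1 hx

theorem OccursInPowAt.isExplicitNode_plain_iff {i : ℕ} {x : List α} (hx : OccursInPowAt r i x)
    (hB : B ≤ x.length) :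
    IsExplicitNode (gstSuffixes docs) (plain x) ↔
      x.length - B < explicitHeight docs B r (i + x.length) := by
  rw [← isExplicitNode_plain_windowBefore_iff, ← hx.eq_windowBefore hB]

theorem OccursInPowAt.isLocus_periodicLocus {i : ℕ} {x : List α} (hx : OccursInPowAt r i x)
    (hB : B ≤ x.length) (hmem : plain x ∈ trieNodes (gstSuffixes docs)) :
    IsLocus (gstSuffixes docs) (plain x)
      (periodicLocus docs B r (i + x.length) (x.length - B)) := by
  rw [periodicLocus, ← hx.eq_windowBefore hB]
  exact isLocus_searchLocus (fun _ => exists_isLocus_gstSuffixes) hmem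

theorem sum_explicitHeight_le_mul :
    ∑ c, explicitHeight docs B r c ≤ r.length * ((docs.map List.length).sum + 1) := by
  calc ∑ c, explicitHeight docs B r c ≤ ∑ _c : ZMod r.length, ((docs.map List.length).sum + 1) :=
        Finset.sum_le_sum fun c _ => explicitHeight_le c
    _ = r.length * ((docs.map List.length).sum + 1) := by simp [ZMod.card]

end PeriodicLocus

theorem table_size_lt_two_pow {p n s W : ℕ} (hp : 0 < p) (hpn : 2 * p ≤ n) (hs : s ≤ p * (n + 1))
    (hW : n ^ 5 ≤ 2 ^ W) : 4 + 4 * p + 5 * s < 2 ^ W := by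
  have hn : 2 ≤ n := by omega
  calc 4 + 4 * p + 5 * s < 8 * n ^ 2 := by nlinarith
    _ = 2 ^ 3 * n ^ 2 := by norm_num
    _ ≤ n ^ 3 * n ^ 2 := by gcongr
    _ = n ^ 5 := by ring
    _ ≤ 2 ^ W := hW

theorem add_lt_two_pow {p n W : ℕ} (hp : 0 < p) (hpn : 2 * p ≤ n) (hW : n ^ 5 ≤ 2 ^ W) :
    p + n < 2 ^ W := by
  have hn : 2 ≤ n := by omega
  calc p + n < 2 * n := by omega
    _ ≤ n * n := by gcongr
    _ ≤ n ^ 5 := by rw [← sq]; exact Nat.pow_le_pow_right (by omega) (by norm_num)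
    _ ≤ 2 ^ W := hW

theorem nat_le_mul_logb_add_one (p : ℕ) : (p : ℝ) ≤ p * Real.logb 2 p + 1 := by
  rcases lt_or_ge p 2 with h | h
  · interval_cases p <;> simp
  · have h1 : (1 : ℝ) ≤ Real.logb 2 p := by
      rw [Real.le_logb_iff_rpow_le one_lt_two (by positivity)]
      simpa using (by exact_mod_cast h : (2 : ℝ) ≤ p)
    nlinarith [(Nat.cast_nonneg p : (0 : ℝ) ≤ p)]

theorem mainTheorem9_general :
    ∃ (query : WordRAM.Program) (C κ : ℕ),
      ∀ (α : Type*) (docs : List (List α)) (r : List α) (ℓ W : ℕ)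
        (addr : List (α ⊕ ℕ) → ℕ),
        IsPrimitive r →
        2 * r.length ≤ ℓ →
        (docs.map List.length).sum ^ κ ≤ 2 ^ W →
        (∀ v, IsExplicitNode (gstSuffixes docs) v → addr v < 2 ^ W) →
        ∃ D : List ℕ,
          (∀ a ∈ D, a < 2 ^ W) ∧
          D.length ≤ C * (r.length + numExplicitPeriodic docs r ℓ) ∧
          ∀ (i : ℕ) (x : List α),
            i < r.length →
            OccursInPowAt r i x →
            ℓ + 2 * r.length ≤ 2 * x.length →
            plain x ∈ trieNodes (gstSuffixes docs) →
            ∃ v, IsLocus (gstSuffixes docs) (plain x) v ∧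
              ∃ tag : ℕ,
                (IsExplicitNode (gstSuffixes docs) (plain x) → tag = 0) ∧
                (¬ IsExplicitNode (gstSuffixes docs) (plain x) → tag = 1) ∧
                WordRAM.AnswersWithin W query C D i x.length (addr v) tag := by
  refine ⟨WordRAM.lookupProgram, 25, 5, fun α docs r ℓ W addr hprim hℓ hW haddr => ?_⟩
  by_cases hlong : ∃ x : List α, ℓ + 2 * r.length ≤ 2 * x.length ∧
      plain x ∈ trieNodes (gstSuffixes docs)
  swap
  · exact ⟨[], by simp, by simp, fun i x _ _ hx hmem => absurd ⟨x, hx, hmem⟩ hlong⟩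
  obtain ⟨x₀, hx₀, hmem₀⟩ := hlong
  have hx₀n := length_le_of_plain_mem hmem₀
  have hroot := mem_trieNodes_of_prefix List.nil_prefix hmem₀
  have := hprim.neZero_length
  have hp : 0 < r.length := NeZero.pos _
  obtain ⟨B, hℓB, hBℓ⟩ : ∃ B, ℓ ≤ 2 * B ∧ 2 * B ≤ ℓ + 1 := ⟨(ℓ + 1) / 2, by omega, by omega⟩
  have hsum := sum_explicitHeight_le (docs := docs) hprim hℓB (by omega)
  have hsize := table_size_lt_two_pow hp (by omega) (sum_explicitHeight_le_mul (B := B)) hW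
  have hnW : r.length + (docs.map List.length).sum < 2 ^ W := add_lt_two_pow hp (by omega) hW
  refine ⟨(WordRAM.periodicTable (explicitHeight docs B r)
    (fun c y => addr (periodicLocus docs B r c y)) B).image, ?_, ?_, fun i x hi hx hxℓ hmem => ?_⟩
  · exact WordRAM.lt_of_mem_periodicTable_image
      (fun c y => haddr _ (isExplicitNode_periodicLocus hroot c y)) (by omega) (by omega)
  · exact WordRAM.length_periodicTable_image_le.trans (by omega)
  · have hxn := length_le_of_plain_mem hmem
    have hBx : B ≤ x.length := by omega
    have hexplicit := hx.isExplicitNode_plain_iff (docs := docs) hBx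
    exact ⟨_, hx.isLocus_periodicLocus hBx hmem, _, fun he => if_neg (hexplicit.1 he).not_ge,
      fun hne => if_pos (not_lt.1 (hexplicit.not.1 hne)),
      WordRAM.periodicTable_answersWithin
        (fun c y hy => congrArg addr (periodicLocus_add_one hy)) hsize hi (by omega) (by omega)⟩

theorem mainTheorem9 :
    ∃ (query : WordRAM.Program) (C κ : ℕ),
      ∀ (α : Type*) (docs : List (List α)) (r : List α) (ℓ W : ℕ)
        (addr : List (α ⊕ ℕ) → ℕ),
        IsPrimitive r →
        4 * r.length ≤ ℓ →
        -- the word size `W` is at least `κ log₂ n`, where `n` is the total length of the documents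
        (docs.map List.length).sum ^ κ ≤ 2 ^ W →
        -- the pointers to the explicit nodes are arbitrary distinct words
        Set.InjOn addr {v | IsExplicitNode (gstSuffixes docs) v} →
        (∀ v, IsExplicitNode (gstSuffixes docs) v → addr v < 2 ^ W) →
        ∃ D : List ℕ,
          (∀ a ∈ D, a < 2 ^ W) ∧
          (D.length : ℝ) ≤
            C * (r.length * Real.logb 2 r.length + numExplicitPeriodic docs r ℓ + 1) ∧
          ∀ (i : ℕ) (x : List α),
            i < r.length →
            OccursInPowAt r i x →
            3 * ℓ ≤ 4 * x.length →
            plain x ∈ trieNodes (gstSuffixes docs) →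
            ∃ v, IsLocus (gstSuffixes docs) (plain x) v ∧
              ∃ tag : ℕ,
                (IsExplicitNode (gstSuffixes docs) (plain x) → tag = 0) ∧
                (¬ IsExplicitNode (gstSuffixes docs) (plain x) → tag = 1) ∧
                WordRAM.AnswersWithin W query C D i x.length (addr v) tag := by
  obtain ⟨query, C, κ, hgeneral⟩ := mainTheorem9_general
  refine ⟨query, C, κ, fun α docs r ℓ W addr hprim hℓ hW _ haddr => ?_⟩
  obtain ⟨D, hD, hlen, hquery⟩ := hgeneral α docs r ℓ W addr hprim (by omega) hW haddr
  refine ⟨D, hD, ?_, fun i x hi hx hxℓ => hquery i x hi hx (by omega)⟩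
  calc (D.length : ℝ) ≤ C * (r.length + numExplicitPeriodic docs r ℓ) := by exact_mod_cast hlen
    _ ≤ _ := mul_le_mul_of_nonneg_left
        (by linarith [nat_le_mul_logb_add_one r.length]) C.cast_nonneg
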